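/- Let $G$ be a group. A non-empty subset $S\subseteq G$ is product-free if $S\cap SS=\varnothing$, where $SS=\{ab : a,b\in S\}$; it is locally maximal product-free if, in addition, no product-free subset of $G$ properly contains $S$. The group $G$ is called filled if every locally maximal product-free set $S$ in $G$ satisfies $G\setminus\{1\}\subseteq S\cup SS$. A group of order $2^m$ is said to be of maximal class if $m>2$ and its nilpotency class is $m-1$. Then the only filled 2-group of maximal class is the dihedral group $D_8$ of order 8. That is, a group $G$ is both a (finite) 2-group of maximal class and filled if and only if $G\cong D_8$. -/

import Mathlib

open scoped Pointwise

namespace FilledGroup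

/-- A product-free subset `S` of a group: `S` is non-empty and `S ∩ SS = ∅`. -/
def IsProductFree {G : Type*} [Group G] (S : Set G) : Prop :=
  S.Nonempty ∧ S ∩ (S * S) = ∅

/-- A locally maximal product-free set: a product-free set that is not properly contained in
any product-free set. -/
def IsLocallyMaximal {G : Type*} [Group G] (S : Set G) : Prop :=
  IsProductFree S ∧ ∀ T : Set G, IsProductFree T → S ⊆ T → S = T

/-- `S` fills `G`: every non-identity element of `G` lies in `S ∪ SS`. -/
def Fills {G : Type*} [Group G] (S : Set G) : Prop :=
  {g : G | g ≠ 1} ⊆ S ∪ S * S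

/-- A filled group: every locally maximal product-free set is complete, that is, fills it. -/
def IsFilled (G : Type*) [Group G] : Prop :=
  ∀ S : Set G, IsLocallyMaximal S → Fills S

/-- A group of order `p ^ m` is of maximal class if `m > 2` and it has nilpotency class
`m - 1`. -/
def IsMaximalClass (p : ℕ) (G : Type*) [Group G] : Prop :=
  ∃ m : ℕ, 2 < m ∧ Nat.card G = p ^ m ∧
    Group.IsNilpotent G ∧ Group.nilpotencyClass G = m - 1

end FilledGroup

namespace FilledGroup

/-! ### Product-free sets and quotients -/

section General

variable {G H : Type*} [Group G] [Group H]

/-! Filledness passes to quotients, because locally maximal sets pull back along surjections. In a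
2-group of maximal class the centre has order 2 and the central quotient is again of maximal class,
so orders above 16 reduce to 16. At order 16 the central quotient is nonabelian of order 8; lifting
its generators gives `x ^ 8 = 1`, `s * x = x ^ k * s`, `s * s = x ^ c` with `k ∈ {3, 7}` and `c ∈
{0, 4}`. In all four cases `{x, x ^ 6, s, x ^ 4 * s}` is locally maximal and misses `x ^ 3`. At
order 8 only the dihedral and quaternion groups occur: the quaternion group fails through `{x ^ 2}`,
and the dihedral one is checked by enumeration. -/

theorem IsProductFree.mul_notMem {S : Set G} (hS : IsProductFree S) {a b : G} (ha : a ∈ S)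
    (hb : b ∈ S) : a * b ∉ S := fun h =>
  Set.eq_empty_iff_forall_notMem.1 hS.2 _ ⟨h, Set.mul_mem_mul ha hb⟩

theorem isProductFree_iff {S : Set G} :
    IsProductFree S ↔ S.Nonempty ∧ ∀ a ∈ S, ∀ b ∈ S, a * b ∉ S := by
  refine ⟨fun h => ⟨h.1, fun a ha b hb => h.mul_notMem ha hb⟩, fun h => ⟨h.1, ?_⟩⟩
  rw [Set.eq_empty_iff_forall_notMem]
  rintro _ ⟨hx, a, ha, b, hb, rfl⟩
  exact h.2 a ha b hb hx

theorem IsProductFree.one_notMem {S : Set G} (hS : IsProductFree S) : (1 : G) ∉ S := fun h =>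
  hS.mul_notMem h h (by simpa using h)

/-- A product-free set is locally maximal if and only if it has no product-free extension by a
single element. -/
theorem isLocallyMaximal_iff {S : Set G} :
    IsLocallyMaximal S ↔ IsProductFree S ∧
      ∀ x ∉ S, ∃ a ∈ insert x S, ∃ b ∈ insert x S, a * b ∈ insert x S := by
  refine ⟨fun h => ⟨h.1, fun x hx => ?_⟩, fun h => ⟨h.1, fun T hT hST => ?_⟩⟩
  · by_contra! hcon
    have := h.2 (insert x S) (isProductFree_iff.2 ⟨⟨x, Set.mem_insert _ _⟩, hcon⟩)
      (Set.subset_insert _ _)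
    exact hx (this ▸ Set.mem_insert x S)
  · refine hST.antisymm fun x hxT => ?_
    by_contra hx
    obtain ⟨a, ha, b, hb, hab⟩ := h.2 x hx
    have hsub : insert x S ⊆ T := Set.insert_subset hxT hST
    exact hT.mul_notMem (hsub ha) (hsub hb) (hsub hab)

theorem IsLocallyMaximal.preimage {f : G →* H} (hf : Function.Surjective f) {S : Set H}
    (hS : IsLocallyMaximal S) : IsLocallyMaximal (f ⁻¹' S) := by
  obtain ⟨hpf, hmax⟩ := isLocallyMaximal_iff.1 hS
  have h1 := hpf.one_notMem
  refine isLocallyMaximal_iff.2 ⟨isProductFree_iff.2 ⟨hpf.1.preimage hf, fun a ha b hb h => ?_⟩,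
    fun x hx => ?_⟩
  · exact hpf.mul_notMem ha hb (by simpa using h)
  obtain ⟨a, ha, b, hb, hab⟩ := hmax (f x) hx
  have lift : ∀ c ∈ S, ∃ d, f d = c ∧ d ∈ insert x (f ⁻¹' S) := fun c hc => by
    obtain ⟨d, rfl⟩ := hf c
    exact ⟨d, rfl, Or.inr hc⟩
  have hxm : x ∈ insert x (f ⁻¹' S) := Set.mem_insert _ _
  by_cases hx1 : f x = 1
  · obtain ⟨s, hs⟩ := hpf.1
    obtain ⟨d, rfl⟩ := hf s
    exact ⟨x, hxm, d, Or.inr hs, Or.inr (by simpa [hx1] using hs)⟩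
  rcases ha with rfl | ha <;> rcases hb with rfl | hb
  · rcases hab with hab | hab
    · exact absurd (by simpa using hab) hx1
    · exact ⟨x, hxm, x, hxm, Or.inr (by simpa using hab)⟩
  · obtain ⟨d, rfl, hd⟩ := lift b hb
    rcases hab with hab | hab
    · exact absurd ((mul_eq_left.1 hab) ▸ hb) h1
    · exact ⟨x, hxm, d, hd, Or.inr (by simpa using hab)⟩
  · obtain ⟨d, rfl, hd⟩ := lift a ha
    rcases hab with hab | hab
    · exact absurd ((mul_eq_right.1 hab) ▸ ha) h1
    · exact ⟨d, hd, x, hxm, Or.inr (by simpa using hab)⟩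
  · obtain ⟨d, rfl, hd⟩ := lift a ha
    rcases hab with hab | hab
    · refine ⟨d, hd, d⁻¹ * x, Or.inr ?_, by simp⟩
      simpa [← hab] using hb
    · exact absurd hab (hpf.mul_notMem ha hb)

theorem IsFilled.of_surjective (hG : IsFilled G) (f : G →* H) (hf : Function.Surjective f) :
    IsFilled H := by
  intro S hS h hne
  obtain ⟨g, rfl⟩ := hf h
  have hg : g ≠ 1 := fun h => hne (by rw [h, map_one])
  rcases hG _ (hS.preimage hf) hg with h | ⟨a, ha, b, hb, rfl⟩
  · exact Or.inl h
  · exact Or.inr ⟨f a, ha, f b, hb, (map_mul f a b).symm⟩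

end General

theorem isFilled_dihedralGroup_four : IsFilled (DihedralGroup 4) := by
  classical
  have key : ∀ S : Finset (DihedralGroup 4), S.Nonempty → (∀ a ∈ S, ∀ b ∈ S, a * b ∉ S) →
      (∀ x ∉ S, ∃ a ∈ insert x S, ∃ b ∈ insert x S, a * b ∈ insert x S) →
      ∀ g ≠ 1, g ∈ S ∨ ∃ a ∈ S, ∃ b ∈ S, a * b = g := by
    decide +kernel
  intro S hS g hg
  obtain ⟨hpf, hmax⟩ := isLocallyMaximal_iff.1 hS
  obtain ⟨hne, hpf⟩ := isProductFree_iff.1 hpf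
  have h := key S.toFinset (by simpa using hne) (by simpa using hpf)
    (fun x hx => by
      obtain ⟨a, ha, b, hb, hab⟩ := hmax x (by simpa using hx)
      exact ⟨a, by simpa using ha, b, by simpa using hb, by simpa using hab⟩) g hg
  simpa [Set.mem_mul] using h

/-! ### Groups with a cyclic subgroup of index two -/

section Metacyclic

variable {G : Type*} [Group G]

theorem pow_val_add {n : ℕ} [NeZero n] {x : G} (hx : x ^ n = 1) (i j : ZMod n) :
    x ^ (i + j).val = x ^ i.val * x ^ j.val := by
  rw [ZMod.val_add, ← pow_add, ← pow_eq_pow_mod _ hx]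

theorem mul_pow_val {n : ℕ} {x s : G} (hx : x ^ n = 1) (k : ZMod n)
    (hk : s * x = x ^ k.val * s) (i : ZMod n) : s * x ^ i.val = x ^ (k * i).val * s := by
  rw [ZMod.val_mul, ← pow_eq_pow_mod _ hx, pow_mul]
  exact (SemiconjBy.pow_right (show SemiconjBy s x (x ^ k.val) from hk) i.val).eq

theorem exists_pow_val {n : ℕ} [NeZero n] {x : G} (hx : x ^ n = 1) (i : ℕ) :
    ∃ j : ZMod n, x ^ i = x ^ j.val :=
  ⟨i, by rw [ZMod.val_natCast, ← pow_eq_pow_mod _ hx]⟩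

/-- The multiplication of words `x ^ i * s ^ e` subject to the relations `x ^ 8 = 1`,
`s * x = x ^ k * s` and `s * s = x ^ c`. -/
def wordMul (k c : ZMod 8) (p q : ZMod 8 × Bool) : ZMod 8 × Bool :=
  (p.1 + (if p.2 then k * q.1 else q.1) + (if p.2 && q.2 then c else 0), xor p.2 q.2)

/-- The words `x`, `x ^ 6`, `s`, `x ^ 4 * s`. -/
def wordSet : Finset (ZMod 8 × Bool) := {(1, false), (6, false), (0, true), (4, true)}

/-- The four parameter pairs cover the dihedral, semidihedral and generalized quaternion groups of
order 16; one set serves them all. -/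
theorem wordSet_spec : ∀ k c : ZMod 8, (k = 3 ∨ k = 7) → (c = 0 ∨ c = 4) →
    (∀ a ∈ wordSet, ∀ b ∈ wordSet, wordMul k c a b ∉ wordSet) ∧
    (∀ x ∉ wordSet, ∃ a ∈ insert x wordSet, ∃ b ∈ insert x wordSet,
      wordMul k c a b ∈ insert x wordSet) ∧
    (∀ a ∈ wordSet, ∀ b ∈ wordSet, wordMul k c a b ≠ (3, false)) := by
  intro k c hk hc
  refine ⟨?_, ?_, ?_⟩ <;> revert k c <;> decide +kernel

theorem not_isFilled_of_card_eq_sixteen (hG : Nat.card G = 16) {x s : G} (hx : x ^ 8 = 1)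
    {k c : ZMod 8} (hk : k = 3 ∨ k = 7) (hc : c = 0 ∨ c = 4) (hsx : s * x = x ^ k.val * s)
    (hss : s * s = x ^ c.val) (hgen : ∀ g : G, ∃ i : ℕ, g = x ^ i ∨ g = x ^ i * s) :
    ¬ IsFilled G := by
  let φ : ZMod 8 × Bool → G := fun p => x ^ p.1.val * if p.2 then s else 1
  have hmul : ∀ p q, φ (wordMul k c p q) = φ p * φ q := by
    rintro ⟨i, a⟩ ⟨j, b⟩
    have h := mul_pow_val hx k hsx j
    cases a <;> cases b <;> simp only [φ, wordMul, pow_val_add hx] <;> simp [mul_assoc]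
    · exact h.symm
    · rw [← hss, ← mul_assoc s, h, mul_assoc]
  have hsurj : Function.Surjective φ := by
    intro g
    obtain ⟨i, h⟩ := hgen g
    obtain ⟨j, hj⟩ := exists_pow_val hx i
    rcases h with h | h
    · exact ⟨(j, false), by simp [φ, h, hj]⟩
    · exact ⟨(j, true), by simp [φ, h, hj]⟩
  have hinj : Function.Injective φ :=
    ((Nat.bijective_iff_surjective_and_card φ).2 ⟨hsurj, by simp [hG]⟩).1
  obtain ⟨h1, h2, h3⟩ := wordSet_spec k c hk hc
  have hmem : ∀ p, φ p ∈ φ '' wordSet ↔ p ∈ wordSet := fun p => by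
    rw [hinj.mem_set_image]; simp
  have hS : IsLocallyMaximal (φ '' (wordSet : Set (ZMod 8 × Bool))) := by
    refine isLocallyMaximal_iff.2 ⟨isProductFree_iff.2 ⟨⟨φ (1, false), ?_⟩, ?_⟩, fun g hg => ?_⟩
    · rw [hmem]; decide
    · rintro _ ⟨a, ha, rfl⟩ _ ⟨b, hb, rfl⟩
      rw [← hmul, hmem]
      exact h1 a ha b hb
    · obtain ⟨p, rfl⟩ := hsurj g
      obtain ⟨a, ha, b, hb, hab⟩ := h2 p (by rwa [hmem] at hg)
      have himg : ∀ q ∈ insert p wordSet, φ q ∈ insert (φ p) (φ '' wordSet) := fun q hq => by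
        rcases Finset.mem_insert.1 hq with rfl | hq
        · exact Set.mem_insert _ _
        · exact Or.inr ((hmem q).2 hq)
      exact ⟨φ a, himg a ha, φ b, himg b hb, hmul a b ▸ himg _ hab⟩
  intro hF
  have hne : φ (3, false) ≠ 1 := fun h => by
    have : φ (3, false) = φ (0, false) := by rw [h]; simp [φ]
    exact absurd (hinj this) (by decide)
  rcases hF _ hS hne with h | ⟨_, ⟨a, ha, rfl⟩, _, ⟨b, hb, rfl⟩, h⟩
  · rw [hmem] at h
    exact absurd h (by decide)
  · exact h3 a ha b hb (hinj ((hmul a b).trans h))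

theorem nonempty_mulEquiv_dihedralGroup {n : ℕ} [NeZero n] (hG : Nat.card G = 2 * n) {x s : G}
    (hx : x ^ n = 1) (hsx : s * x = x⁻¹ * s) (hss : s * s = 1)
    (hgen : ∀ g : G, ∃ i : ℕ, g = x ^ i ∨ g = x ^ i * s) :
    Nonempty (G ≃* DihedralGroup n) := by
  have hneg : ∀ i : ZMod n, x ^ (-i).val = (x ^ i.val)⁻¹ := fun i => by
    rw [eq_inv_iff_mul_eq_one, ← pow_val_add hx]; simp
  have hcomm : ∀ i : ZMod n, x ^ i.val * s = s * x ^ (-i).val := fun i => by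
    have h := (SemiconjBy.pow_right (show SemiconjBy s x x⁻¹ from hsx) i.val).eq
    rw [hneg, eq_mul_inv_iff_mul_eq, mul_assoc, h, inv_pow, mul_inv_cancel_left]
  let f : DihedralGroup n → G
    | .r i => x ^ i.val
    | .sr i => s * x ^ i.val
  have hf : ∀ a b, f (a * b) = f a * f b := by
    rintro (i | i) (j | j)
    · exact pow_val_add hx i j
    · simp only [DihedralGroup.r_mul_sr, f]
      rw [← mul_assoc, hcomm, mul_assoc, ← pow_val_add hx, neg_add_eq_sub]
    · simp only [DihedralGroup.sr_mul_r, f]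
      rw [pow_val_add hx, mul_assoc]
    · simp only [DihedralGroup.sr_mul_sr, f]
      rw [mul_assoc, ← mul_assoc _ s, hcomm, mul_assoc, ← mul_assoc s s, hss, one_mul,
        ← pow_val_add hx, neg_add_eq_sub]
  have hsurj : Function.Surjective f := by
    intro g
    obtain ⟨i, h⟩ := hgen g
    obtain ⟨j, hj⟩ := exists_pow_val hx i
    rcases h with h | h
    · exact ⟨.r j, by rw [h, hj]⟩
    · exact ⟨.sr (-j), by rw [h, hj, hcomm]⟩
  have hbij : Function.Bijective f :=
    (Nat.bijective_iff_surjective_and_card f).2 ⟨hsurj, by rw [DihedralGroup.nat_card, hG]⟩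
  exact ⟨(MulEquiv.ofBijective (MonoidHom.mk' f hf) hbij).symm⟩

theorem mulCommutative_of_generators {x s : G} (hsx : s * x = x * s)
    (hgen : ∀ g : G, ∃ i : ℕ, g = x ^ i ∨ g = x ^ i * s) : IsMulCommutative G := by
  have h : Commute s x := hsx
  refine ⟨⟨fun a b => ?_⟩⟩
  obtain ⟨i, rfl | rfl⟩ := hgen a <;> obtain ⟨j, rfl | rfl⟩ := hgen b
  · exact Commute.pow_pow_self x i j
  · exact ((Commute.pow_pow_self x i j).mul_right (h.symm.pow_left i))
  · exact ((Commute.pow_pow_self x i j).mul_left (h.pow_right j))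
  · exact (((Commute.pow_pow_self x i j).mul_right (h.symm.pow_left i))).mul_left
      ((h.pow_right j).mul_right (Commute.refl s))

/-- A non-commutative group of order eight satisfies the relations of the dihedral or of the
quaternion group. -/
theorem exists_generators_of_card_eq_eight (hG : Nat.card G = 8) (hnc : ¬ IsMulCommutative G) :
    ∃ x s : G, x ^ 4 = 1 ∧ x ^ 2 ≠ 1 ∧ s * x = x⁻¹ * s ∧ (s * s = 1 ∨ s * s = x ^ 2) ∧
      ∀ g : G, ∃ i : ℕ, g = x ^ i ∨ g = x ^ i * s := by
  have : Finite G := Nat.finite_of_card_ne_zero (by omega)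
  obtain ⟨x, hx2⟩ : ∃ x : G, x ^ 2 ≠ 1 := by
    by_contra! h
    refine hnc ⟨⟨fun a b => ?_⟩⟩
    have inv : ∀ a : G, a⁻¹ = a := fun a => inv_eq_of_mul_eq_one_left (by rw [← sq, h])
    rw [← inv (a * b), mul_inv_rev, inv, inv]
  have hord : orderOf x = 4 := by
    have hd : orderOf x ∣ 2 ^ 3 := (orderOf_dvd_natCard x).trans (by rw [hG]; norm_num)
    obtain ⟨k, hk, h⟩ := (Nat.dvd_prime_pow Nat.prime_two).1 hd
    interval_cases k
    · have hx1 : x = 1 := orderOf_eq_one_iff.1 (by simpa using h)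
      exact absurd (by rw [hx1, one_pow]) hx2
    · exact absurd (orderOf_dvd_iff_pow_eq_one.1 (by simp [h])) hx2
    · simpa using h
    · have := isCyclic_of_orderOf_eq_card x (by rw [h, hG]; norm_num)
      exact absurd IsCyclic.isMulCommutative hnc
  have hx4 : x ^ 4 = 1 := hord ▸ pow_orderOf_eq_one x
  have hidx : (Subgroup.zpowers x).index = 2 := by
    have := (Subgroup.zpowers x).card_mul_index
    rw [Nat.card_zpowers, hord, hG] at this
    omega
  have hpow : ∀ g ∈ Subgroup.zpowers x, ∃ i < 4, g = x ^ i := fun g hg => by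
    classical
    obtain ⟨i, hi, h⟩ := Finset.mem_image.1 (mem_zpowers_iff_mem_range_orderOf.1 hg)
    exact ⟨i, by simpa [hord] using hi, h.symm⟩
  obtain ⟨s, hs⟩ : ∃ s, s ∉ Subgroup.zpowers x := by
    by_contra! h
    rw [(Subgroup.eq_top_iff' _).2 h] at hidx
    simp at hidx
  have hgen : ∀ g : G, ∃ i : ℕ, g = x ^ i ∨ g = x ^ i * s := fun g => by
    by_cases hg : g ∈ Subgroup.zpowers x
    · obtain ⟨i, -, h⟩ := hpow g hg
      exact ⟨i, Or.inl h⟩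
    · have : g * s⁻¹ ∈ Subgroup.zpowers x := by
        rw [Subgroup.mul_mem_iff_of_index_two hidx]; simp [hg, hs]
      obtain ⟨i, -, h⟩ := hpow _ this
      exact ⟨i, Or.inr (by rw [← h, inv_mul_cancel_right])⟩
  have hncomm : ¬ Commute s x := fun h => hnc (mulCommutative_of_generators h.eq hgen)
  refine ⟨x, s, hx4, hx2, ?_, ?_, hgen⟩
  · have hconj : s * x * s⁻¹ ∈ Subgroup.zpowers x :=
      (Subgroup.normal_of_index_eq_two hidx).conj_mem x (Subgroup.mem_zpowers x) s
    obtain ⟨i, hi, h⟩ := hpow _ hconj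
    interval_cases i
    · have hx1 : x = 1 := by simpa using h
      exact absurd (by rw [hx1, one_pow]) hx2
    · exact absurd (show s * x = x * s by simpa [mul_inv_eq_iff_eq_mul] using h) hncomm
    · have : s * x ^ 2 * s⁻¹ = 1 := by rw [← conj_pow, h, ← pow_mul, hx4]
      exact absurd (conj_eq_one_iff.1 this) hx2
    · rw [mul_inv_eq_iff_eq_mul.1 h, eq_inv_of_mul_eq_one_left (a := x ^ 3) (b := x)
        (by rw [← pow_succ, hx4])]
  -- `s * s` commutes with `s`, whereas an odd power of `x` generates `x`; hence `j` is even.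
  · obtain ⟨j, hj, h⟩ := hpow _ (Subgroup.mul_self_mem_of_index_two hidx s)
    have hc : Commute s (x ^ j) := h ▸ (Commute.refl s).mul_right (Commute.refl s)
    interval_cases j
    · exact Or.inl (by simpa using h)
    · exact absurd (by simpa using hc) hncomm
    · exact Or.inr h
    · have h9 : (x ^ 3) ^ 3 = x := by
        rw [← pow_mul, show 3 * 3 = 4 * 2 + 1 by norm_num, pow_succ, pow_mul, hx4, one_pow, one_mul]
      exact absurd (h9 ▸ hc.pow_right 3) hncomm

/-- A non-commutative filled group of order eight is dihedral. -/
theorem IsFilled.nonempty_mulEquiv_dihedralGroup_four (hF : IsFilled G) (hG : Nat.card G = 8)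
    (hnc : ¬ IsMulCommutative G) : Nonempty (G ≃* DihedralGroup 4) := by
  obtain ⟨x, s, hx4, hx2, hsx, hss, hgen⟩ := exists_generators_of_card_eq_eight hG hnc
  rcases hss with hss | hss
  · exact nonempty_mulEquiv_dihedralGroup hG hx4 hsx hss hgen
  -- Quaternion case: every element other than `1` and `x ^ 2` squares to `x ^ 2`, so `{x ^ 2}` is
  -- locally maximal, yet it does not reach `x`.
  exfalso
  have hx22 : x ^ 2 * x ^ 2 = 1 := by rw [← pow_add, hx4]
  have hsq : ∀ i : ℕ, (x ^ i * s) * (x ^ i * s) = x ^ 2 := fun i => by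
    have h := (SemiconjBy.pow_right (show SemiconjBy s x x⁻¹ from hsx) i).eq
    rw [mul_assoc, ← mul_assoc s, h, mul_assoc, hss, inv_pow, mul_inv_cancel_left]
  have hpf : IsProductFree ({x ^ 2} : Set G) := by
    refine isProductFree_iff.2 ⟨⟨_, rfl⟩, ?_⟩
    rintro _ rfl _ rfl h
    exact hx2 ((hx22.symm.trans h).symm)
  have hS : IsLocallyMaximal ({x ^ 2} : Set G) := by
    refine isLocallyMaximal_iff.2 ⟨hpf, fun g hg => ?_⟩
    by_cases hg2 : g * g = x ^ 2
    · exact ⟨g, by simp, g, by simp, by simp [hg2]⟩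
    · have hg1 : g = 1 := by
        obtain ⟨i, rfl | rfl⟩ := hgen g
        · rw [pow_eq_pow_mod i hx4] at hg hg2 ⊢
          have : i % 4 < 4 := Nat.mod_lt _ (by norm_num)
          interval_cases i % 4
          · simp
          · exact absurd (by simp [sq]) hg2
          · exact absurd rfl hg
          · exact absurd (by rw [← pow_add, show 3 + 3 = 4 + 2 by norm_num, pow_add, hx4, one_mul])
              hg2
        · exact absurd (hsq i) hg2
      subst hg1
      exact ⟨1, by simp, 1, by simp, by simp⟩
  have hx1 : x ≠ 1 := fun h => hx2 (by rw [h, one_pow])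
  rcases hF _ hS hx1 with h | ⟨a, ha, b, hb, h⟩
  · have : x * x = x * 1 := by rw [← sq, mul_one]; exact h.symm
    exact hx1 (mul_left_cancel this)
  · rw [Set.mem_singleton_iff.1 ha, Set.mem_singleton_iff.1 hb] at h
    exact hx1 (h.symm.trans hx22)

end Metacyclic

/-! ### Maximal class and the descent to order 16 -/

section NilpotencyClass

open Subgroup

theorem card_quotient_center {G : Type*} [Group G] {m : ℕ} (hG : Nat.card G = 2 ^ m)
    (hm : 0 < m) : ∃ j, 0 < j ∧ j ≤ m ∧ Nat.card (center G) = 2 ^ j ∧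
      Nat.card (G ⧸ center G) = 2 ^ (m - j) := by
  obtain ⟨j, hj, hZ⟩ := IsPGroup.card_center_eq_prime_pow hG hm
  have hmul := (center G).card_mul_index
  rw [hZ, hG] at hmul
  have hjm : j ≤ m := (Nat.pow_dvd_pow_iff_le_right (by norm_num : 1 < 2)).1 ⟨_, hmul.symm⟩
  refine ⟨j, hj, hjm, hZ, ?_⟩
  have h2 : 2 ^ j * 2 ^ (m - j) = 2 ^ m := by rw [← pow_add, Nat.add_sub_cancel' hjm]
  exact Nat.eq_of_mul_eq_mul_left (pow_pos (by norm_num) j) (hmul.trans h2.symm)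

theorem isNilpotent_of_card_eq_two_pow {G : Type*} [Group G] {m : ℕ} (hG : Nat.card G = 2 ^ m) :
    Group.IsNilpotent G :=
  have : Finite G := Nat.finite_of_card_ne_zero (by rw [hG]; positivity)
  (IsPGroup.of_card hG).isNilpotent

theorem isMulCommutative_of_card_quotient_center {G : Type*} [Group G] {d : ℕ}
    (hQ : Nat.card (G ⧸ center G) = 2 ^ d) (hd : d ≤ 1) : IsMulCommutative G := by
  have : IsCyclic (G ⧸ center G) :=
    isCyclic_of_card_dvd_prime (p := 2) (by
      rw [hQ]; simpa using Nat.pow_dvd_pow 2 hd)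
  exact isMulCommutative_of_isCyclic_quotient_center_self G

/-- Each central quotient lowers the class by one and the order by a factor of at least 2; a central
quotient of order at most 2 forces commutativity. -/
theorem nilpotencyClass_le_of_card_eq_two_pow {G : Type*} [Group G] {m : ℕ} (hm : 2 ≤ m)
    (hG : Nat.card G = 2 ^ m) : Group.nilpotencyClass G ≤ m - 1 := by
  induction m using Nat.strong_induction_on generalizing G with
  | _ m ih =>
    obtain ⟨j, hj, hjm, -, hQ⟩ := card_quotient_center hG (by omega)
    have := isNilpotent_of_card_eq_two_pow hG
    by_cases h : m - j ≤ 1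
    · have := Group.IsNilpotent.nilpotencyClass_le_one_iff.2
        (isMulCommutative_of_card_quotient_center hQ h)
      omega
    · have := ih (m - j) (by omega) (by omega) hQ
      rw [Group.nilpotencyClass_quotient_center] at this
      omega

/-- A larger centre would leave a quotient too small to have class `m - 2`. -/
theorem card_center_of_nilpotencyClass {G : Type*} [Group G] {m : ℕ} (hm : 2 < m)
    (hG : Nat.card G = 2 ^ m) (hcl : Group.nilpotencyClass G = m - 1) :
    Nat.card (center G) = 2 ∧ Nat.card (G ⧸ center G) = 2 ^ (m - 1) := by
  obtain ⟨j, hj, hjm, hZ, hQ⟩ := card_quotient_center hG (by omega)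
  have := isNilpotent_of_card_eq_two_pow hG
  suffices j = 1 by subst this; exact ⟨by simpa using hZ, hQ⟩
  by_cases h : m - j ≤ 1
  · have := Group.IsNilpotent.nilpotencyClass_le_one_iff.2
      (isMulCommutative_of_card_quotient_center hQ h)
    omega
  · have := nilpotencyClass_le_of_card_eq_two_pow (by omega) hQ
    rw [Group.nilpotencyClass_quotient_center] at this
    omega

theorem not_isMulCommutative_of_nilpotencyClass {G : Type*} [Group G] [Group.IsNilpotent G]
    (h : 1 < Group.nilpotencyClass G) : ¬ IsMulCommutative G := fun hc =>
  absurd (Group.IsNilpotent.nilpotencyClass_le_one_iff.2 hc) (by omega)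

/-- Groups of order 16 and maximal class are not filled. -/
theorem not_isFilled_of_nilpotencyClass_eq_three {G : Type*} [Group G] (hG : Nat.card G = 16)
    (hcl : Group.nilpotencyClass G = 3) : ¬ IsFilled G := by
  obtain ⟨hZ, hQ⟩ := card_center_of_nilpotencyClass (m := 4) (by norm_num) (by omega) hcl
  have := isNilpotent_of_card_eq_two_pow hQ
  have hQc : Group.nilpotencyClass (G ⧸ center G) = 2 := by
    rw [Group.nilpotencyClass_quotient_center, hcl]
  obtain ⟨x', s', hx4, hx2, hsx, hss, hgen⟩ := exists_generators_of_card_eq_eight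
    (by rw [hQ]; norm_num) (not_isMulCommutative_of_nilpotencyClass (by omega))
  obtain ⟨x, rfl⟩ := QuotientGroup.mk_surjective x'
  obtain ⟨s, rfl⟩ := QuotientGroup.mk_surjective s'
  have hmem : ∀ {a b : G}, (a : G ⧸ center G) = b → ∃ ζ ∈ center G, a = b * ζ := fun {a b} h =>
    ⟨b⁻¹ * a, QuotientGroup.eq.1 h.symm, by simp⟩
  have hcomm : ∀ ζ ∈ center G, ∀ g : G, Commute g ζ := fun ζ h g => mem_center_iff.1 h g
  have hsq : ∀ ζ ∈ center G, ζ ^ 2 = 1 := fun ζ h => by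
    have : (⟨ζ, h⟩ : center G) ^ 2 = 1 := hZ ▸ pow_card_eq_one'
    simpa using congrArg Subtype.val this
  have hgen' : ∀ g : G, ∃ i : ℕ, ∃ ζ ∈ center G, g = x ^ i * ζ ∨ g = x ^ i * s * ζ := fun g => by
    obtain ⟨i, h | h⟩ := hgen g
    · obtain ⟨ζ, hζ, h⟩ := hmem (b := x ^ i) (by simpa using h)
      exact ⟨i, ζ, hζ, Or.inl h⟩
    · obtain ⟨ζ, hζ, h⟩ := hmem (b := x ^ i * s) (by simpa using h)
      exact ⟨i, ζ, hζ, Or.inr h⟩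
  -- Otherwise `x ^ 2` would be central, hence trivial in the quotient.
  have hx2s : ¬ Commute s (x ^ 2) := fun h => by
    have hc : x ^ 2 ∈ center G := mem_center_iff.2 fun g => by
      have hxx : ∀ i, Commute (x ^ i) (x ^ 2) := fun i => Commute.pow_pow_self x i 2
      obtain ⟨i, ζ, hζ, rfl | rfl⟩ := hgen' g
      · exact ((hxx i).mul_left (hcomm ζ hζ _).symm).eq
      · exact (((hxx i).mul_left h).mul_left (hcomm ζ hζ _).symm).eq
    exact hx2 (by simpa using (QuotientGroup.eq_one_iff _).2 hc)
  obtain ⟨ζ, hζ, hconj⟩ := hmem (a := s * x) (b := x⁻¹ * s) (by simpa using hsx)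
  have hconj' : SemiconjBy s x (x⁻¹ * ζ) := by
    change s * x = x⁻¹ * ζ * s
    rw [hconj, mul_assoc, mul_assoc, hcomm ζ hζ s]
  -- Squaring kills the central error `ζ`, so `s` inverts `x ^ 2`; this forces `x ^ 4 ≠ 1`.
  have hconj2 : SemiconjBy s (x ^ 2) (x⁻¹ ^ 2) := by
    have := hconj'.pow_right 2
    rwa [(hcomm ζ hζ x⁻¹).mul_pow, hsq ζ hζ, mul_one] at this
  have hx4' : x ^ 4 ∈ center G := (QuotientGroup.eq_one_iff _).1 (by simpa using hx4)
  have hx4ne : x ^ 4 ≠ 1 := fun h => hx2s (by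
    have : x⁻¹ ^ 2 = x ^ 2 := by
      rw [inv_pow, inv_eq_iff_mul_eq_one, ← pow_add, h]
    rwa [this] at hconj2)
  have hx8 : x ^ 8 = 1 := by rw [show 8 = 4 * 2 by norm_num, pow_mul, hsq _ hx4']
  have hcenter : ∀ ζ ∈ center G, ζ = 1 ∨ ζ = x ^ 4 := fun ζ h => by
    by_contra! hcon
    have hcard : ({1, ⟨ζ, h⟩, ⟨x ^ 4, hx4'⟩} : Set (center G)).ncard = 3 := by
      refine Set.ncard_eq_three.2 ⟨_, _, _, ?_, ?_, ?_, rfl⟩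
      · exact fun h => hcon.1 (congrArg Subtype.val h).symm
      · exact fun h => hx4ne (congrArg Subtype.val h).symm
      · exact fun h => hcon.2 (congrArg Subtype.val h)
    have : Finite (center G) := Nat.finite_of_card_ne_zero (by omega)
    have := Set.ncard_le_card ({1, ⟨ζ, h⟩, ⟨x ^ 4, hx4'⟩} : Set (center G))
    omega
  have hgen'' : ∀ g : G, ∃ i : ℕ, g = x ^ i ∨ g = x ^ i * s := fun g => by
    obtain ⟨i, ζ, hζ, h⟩ := hgen' g
    rcases hcenter ζ hζ with rfl | rfl
    · exact ⟨i, by simpa using h⟩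
    · refine ⟨i + 4, h.imp (fun h => by rw [h, pow_add]) fun h => ?_⟩
      rw [h, pow_add, mul_assoc, hcomm _ hζ s, mul_assoc]
  have hxinv : x⁻¹ = x ^ 7 := inv_eq_of_mul_eq_one_right (by rw [← pow_succ', hx8])
  obtain ⟨k, hk, hsxk⟩ : ∃ k : ZMod 8, (k = 3 ∨ k = 7) ∧ s * x = x ^ k.val * s := by
    rcases hcenter ζ hζ with rfl | rfl
    · exact ⟨7, Or.inr rfl, by rw [hconj, mul_one, hxinv]; rfl⟩
    · refine ⟨3, Or.inl rfl, hconj'.eq.trans ?_⟩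
      congr 1
      rw [inv_mul_eq_iff_eq_mul, ← pow_succ']
      rfl
  obtain ⟨c, hc, hssc⟩ : ∃ c : ZMod 8, (c = 0 ∨ c = 4) ∧ s * s = x ^ c.val := by
    rcases hss with hss | hss
    · have : s * s ∈ center G := (QuotientGroup.eq_one_iff _).1 (by simpa using hss)
      rcases hcenter _ this with h | h
      · exact ⟨0, Or.inl rfl, by simpa using h⟩
      · exact ⟨4, Or.inr rfl, h⟩
    -- A quaternion quotient is impossible: `x ^ 2` would be `s * s` times a central element and so
    -- commute with `s`.
    · obtain ⟨ξ, hξ, h⟩ := hmem (a := s * s) (b := x ^ 2) (by simpa using hss)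
      refine absurd ?_ hx2s
      have h2 : x ^ 2 = s * s * ξ⁻¹ := by rw [h, mul_inv_cancel_right]
      rw [h2]
      exact ((Commute.refl s).mul_right (Commute.refl s)).mul_right (hcomm ξ hξ s).inv_right
  exact not_isFilled_of_card_eq_sixteen hG hx8 hk hc hsxk hssc hgen''

theorem not_isFilled_of_nilpotencyClass {G : Type*} [Group G] {m : ℕ} (hm : 4 ≤ m)
    (hG : Nat.card G = 2 ^ m) (hcl : Group.nilpotencyClass G = m - 1) : ¬ IsFilled G := by
  induction m, hm using Nat.le_induction generalizing G with
  | base => exact not_isFilled_of_nilpotencyClass_eq_three (by simpa using hG) hcl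
  | succ m hm ih =>
    intro hF
    refine ih (card_center_of_nilpotencyClass (by omega) hG hcl).2 ?_
      (hF.of_surjective (QuotientGroup.mk' (center G)) (QuotientGroup.mk'_surjective _))
    rw [Group.nilpotencyClass_quotient_center, hcl]
    omega

end NilpotencyClass

end FilledGroup

theorem mainTheorem12 (G : Type*) [Group G] :
    (FilledGroup.IsMaximalClass 2 G ∧ FilledGroup.IsFilled G) ↔
      Nonempty (G ≃* DihedralGroup 4) := by
  constructor
  · rintro ⟨⟨m, hm, hG, hN, hcl⟩, hF⟩
    by_cases h4 : 4 ≤ m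
    · exact absurd hF (FilledGroup.not_isFilled_of_nilpotencyClass h4 hG hcl)
    · obtain rfl : m = 3 := by omega
      exact hF.nonempty_mulEquiv_dihedralGroup_four (by simpa using hG)
        (FilledGroup.not_isMulCommutative_of_nilpotencyClass (by omega))
  · rintro ⟨e⟩
    have hG : Nat.card G = 2 ^ 3 := by
      rw [Nat.card_congr e.toEquiv, DihedralGroup.nat_card]; norm_num
    have hN := FilledGroup.isNilpotent_of_card_eq_two_pow hG
    refine ⟨⟨3, by norm_num, hG, hN, le_antisymm
      (FilledGroup.nilpotencyClass_le_of_card_eq_two_pow (by norm_num) hG) ?_⟩,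
      FilledGroup.isFilled_dihedralGroup_four.of_surjective e.symm.toMonoidHom e.symm.surjective⟩
    by_contra! h
    have hc := Group.IsNilpotent.nilpotencyClass_le_one_iff.1 (Nat.le_of_lt_succ h)
    have : DihedralGroup.r (1 : ZMod 4) * .sr 0 = .sr 0 * .r 1 :=
      e.symm.injective (by rw [map_mul, map_mul]; exact hc.is_comm.comm _ _)
    exact absurd this (by decide)
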